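/- **Conventions.** An inverse monoid with zero is a monoid $S$ with an absorbing element $0$ in which each $s$ has a unique $s^{-1}$ with $s=ss^{-1}s$ and $s^{-1}=s^{-1}ss^{-1}$. Its set of idempotents is $\mathsf{E}(S)$ and its group of units is $\mathsf{U}(S)$. It is ordered by the natural partial order: $a\le b$ if and only if $a=ba^{-1}a$. Write $a\sim b$ (compatible) if $a^{-1}b,\,ab^{-1}\in \mathsf{E}(S)$. The monoid $S$ is a *Boolean inverse monoid* if $\mathsf{E}(S)$ is a Boolean algebra under $\le$, every two compatible elements have a join, and multiplication distributes on both sides over such joins. It is a $\wedge$-*monoid* if every two elements have a meet. A *Tarski monoid* is a countably infinite Boolean inverse $\wedge$-monoid. It is *simple* if * it is fundamental: every element that commutes with all idempotents is itself an idempotent; and * it is $0$-simplifying: the only (non-empty, two-sided) ideals $X$ that equal the set of all joins of finite compatible subsets of $X$ are $\{0\}$ and $S$. Let $\bar e$ denote the complement of $e$ in $\mathsf{E}(S)$. The *support* of $s\in S$ is $\sigma(s)=\overline{(s\wedge 1)}\,s^{-1}s\in\mathsf{E}(S)$. A *special involution* is a unit of the form $a^{-1}\vee a\vee\overline{(a^{-1}a\vee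 aa^{-1})}$ with $a\neq 0$ and $a^2=0$. The group $\mathsf{Sym}(S)$ is the subgroup of $\mathsf{U}(S)$ generated by the special involutions. An *involution* in a group is an element $t\ne 1$ with $t^2=1$. **Corollary.** Let $S$ and $T$ be simple Tarski monoids. Let $G$ be a subgroup of $\mathsf{U}(S)$ containing $\mathsf{Sym}(S)$, let $H$ be a subgroup of $\mathsf{U}(T)$ containing $\mathsf{Sym}(T)$, and let $\alpha\colon G\to H$ be an isomorphism of groups. Then there is an isomorphism of Boolean algebras $\gamma\colon \mathsf{E}(S)\to\mathsf{E}(T)$ such that: 1. $\gamma(\sigma(t))=\sigma(\alpha(t))$ for each involution $t$ in $G$; 2. $\gamma(geg^{-1})=\alpha(g)\,\gamma(e)\,\alpha(g)^{-1}$ for all $g\in G$ and all $e\in\mathsf{E}(S)$. -/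

import Mathlib

universe u

/-- An inverse monoid with zero: each element `s` has exactly one generalized inverse `s⁻¹`. -/
class InverseMonoidWithZero (S : Type u) extends MonoidWithZero S, Inv S where
  mul_inv_mul_self : ∀ s : S, s * s⁻¹ * s = s
  inv_mul_inv_self : ∀ s : S, s⁻¹ * s * s⁻¹ = s⁻¹
  inv_unique : ∀ s t : S, s * t * s = s → t * s * t = t → t = s⁻¹

namespace InverseMonoidWithZero

section Basic

variable {S : Type u} [InverseMonoidWithZero S]

theorem idem_inv_mul (s : S) : IsIdempotentElem (s⁻¹ * s) := by
  unfold IsIdempotentElem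
  rw [← mul_assoc, inv_mul_inv_self]

theorem idem_mul_inv (s : S) : IsIdempotentElem (s * s⁻¹) := by
  unfold IsIdempotentElem
  rw [← mul_assoc, mul_inv_mul_self]

theorem idem_mul {e f : S} (he : IsIdempotentElem e) (hf : IsIdempotentElem f) :
    IsIdempotentElem (e * f) := by
  have he2 : ∀ x, e * (e * x) = e * x := fun x => by rw [← mul_assoc, he.eq]
  have hf2 : ∀ x, f * (f * x) = f * x := fun x => by rw [← mul_assoc, hf.eq]
  have h1 := mul_inv_mul_self (e * f)
  have h2 := inv_mul_inv_self (e * f)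
  generalize hx : (e * f)⁻¹ = x at h1 h2
  have h2' : x * (e * (f * x)) = x := by simpa only [mul_assoc] using h2
  have h2e : x * (e * (f * (x * e))) = x * e := by
    calc x * (e * (f * (x * e))) = x * (e * (f * x)) * e := by simp only [mul_assoc]
      _ = x * e := by rw [h2']
  have h3 : f * x * e = x := by
    rw [← hx]
    apply inv_unique
    · rw [hx]
      simp only [mul_assoc] at h1 ⊢
      rw [hf2, he2, h1]
    · rw [hx]
      simp only [mul_assoc]
      rw [he2, hf2, h2e]
  have h4 : x * x = x := by
    calc x * x = (f * x * e) * (f * x * e) := by rw [h3]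
      _ = f * (x * (e * (f * (x * e)))) := by simp only [mul_assoc]
      _ = x := by rw [h2e, ← mul_assoc, h3]
  have h5 : x = x⁻¹ := inv_unique x x (by rw [h4, h4]) (by rw [h4, h4])
  have h6 : e * f = x⁻¹ := inv_unique x (e * f) h2 h1
  rw [h6, ← h5]
  exact h4

/-- Idempotents commute. -/
theorem idem_comm {e f : S} (he : IsIdempotentElem e) (hf : IsIdempotentElem f) :
    e * f = f * e := by
  have h1 := idem_mul he hf
  have h2 := idem_mul hf he
  have he2 : ∀ x, e * (e * x) = e * x := fun x => by rw [← mul_assoc, he.eq]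
  have hf2 : ∀ x, f * (f * x) = f * x := fun x => by rw [← mul_assoc, hf.eq]
  have k1 : e * (f * (e * f)) = e * f := by
    have := h1.eq
    simpa only [mul_assoc] using this
  have k2 : f * (e * (f * e)) = f * e := by
    have := h2.eq
    simpa only [mul_assoc] using this
  have a1 : e * f = (e * f)⁻¹ := inv_unique _ _ (by rw [h1.eq, h1.eq]) (by rw [h1.eq, h1.eq])
  have a2 : f * e = (e * f)⁻¹ := by
    apply inv_unique
    · simp only [mul_assoc]
      rw [hf2, he2, k1]
    · simp only [mul_assoc]
      rw [he2, hf2, k2]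
  rw [a1, ← a2]

theorem dom_mul_of_eq {a b : S} (h : a = b * a⁻¹ * a) : a⁻¹ * a * (b⁻¹ * b) = a⁻¹ * a := by
  have h1 : a * (b⁻¹ * b) = a := by
    calc a * (b⁻¹ * b) = b * a⁻¹ * a * (b⁻¹ * b) := by rw [← h]
      _ = b * ((a⁻¹ * a) * (b⁻¹ * b)) := by simp only [mul_assoc]
      _ = b * ((b⁻¹ * b) * (a⁻¹ * a)) := by rw [idem_comm (idem_inv_mul a) (idem_inv_mul b)]
      _ = b * b⁻¹ * b * a⁻¹ * a := by simp only [mul_assoc]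
      _ = a := by rw [mul_inv_mul_self, ← h]
  rw [mul_assoc, h1]

/-- The natural partial order: `a ≤ b` if and only if `a = b a⁻¹ a`. -/
instance instPartialOrder : PartialOrder S where
  le a b := a = b * a⁻¹ * a
  le_refl a := (mul_inv_mul_self a).symm
  le_trans a b c hab hbc := by
    have h1 := dom_mul_of_eq hab
    rw [idem_comm (idem_inv_mul a) (idem_inv_mul b)] at h1
    calc a = b * a⁻¹ * a := hab
      _ = c * b⁻¹ * b * a⁻¹ * a := by rw [← hbc]
      _ = c * ((b⁻¹ * b) * (a⁻¹ * a)) := by simp only [mul_assoc]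
      _ = c * a⁻¹ * a := by rw [h1, mul_assoc]
  le_antisymm a b hab hba := by
    have h1 := dom_mul_of_eq hab
    have h2 := dom_mul_of_eq hba
    rw [idem_comm (idem_inv_mul a) (idem_inv_mul b)] at h1
    calc a = b * a⁻¹ * a := hab
      _ = b * (a⁻¹ * a) := by rw [mul_assoc]
      _ = b * (b⁻¹ * b) := by rw [← h1, h2]
      _ = b := by rw [← mul_assoc, mul_inv_mul_self]

theorem idem_of_le_one {a : S} (h : a ≤ 1) : IsIdempotentElem a := by
  have h1 : a = 1 * a⁻¹ * a := h
  rw [one_mul] at h1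
  rw [h1]
  exact idem_inv_mul a

/-- The compatibility relation `a ∼ b`. -/
def Compatible (a b : S) : Prop :=
  IsIdempotentElem (a⁻¹ * b) ∧ IsIdempotentElem (a * b⁻¹)

end Basic

/-- The set `E(S)` of idempotents of `S`, as a type. -/
structure Idem (S : Type u) [InverseMonoidWithZero S] : Type u where
  val : S
  idem : IsIdempotentElem val

/-- The domain idempotent `d(s) = s⁻¹ s`. -/
def dom {S : Type u} [InverseMonoidWithZero S] (s : S) : Idem S := ⟨s⁻¹ * s, idem_inv_mul s⟩

/-- The range idempotent `r(s) = s s⁻¹`. -/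
def ran {S : Type u} [InverseMonoidWithZero S] (s : S) : Idem S := ⟨s * s⁻¹, idem_mul_inv s⟩

/-- The natural action of the group of units on the idempotents, `e ↦ g e g⁻¹`. -/
def conj {S : Type u} [InverseMonoidWithZero S] (g : Sˣ) (e : Idem S) : Idem S where
  val := (g : S) * e.val * ((g⁻¹ : Sˣ) : S)
  idem := by
    have h : e.val * e.val = e.val := e.idem
    calc (g : S) * e.val * ((g⁻¹ : Sˣ) : S) * ((g : S) * e.val * ((g⁻¹ : Sˣ) : S))
        = (g : S) * e.val * (((g⁻¹ : Sˣ) : S) * (g : S)) * e.val * ((g⁻¹ : Sˣ) : S) := by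
          simp only [mul_assoc]
      _ = (g : S) * e.val * ((g⁻¹ : Sˣ) : S) := by
          rw [Units.inv_mul, mul_one, mul_assoc (g : S), h]

end InverseMonoidWithZero

open InverseMonoidWithZero in
/-- A Boolean inverse monoid: the idempotents form a Boolean algebra under the natural partial
order, binary compatible joins exist, and multiplication distributes over them. -/
class BooleanInverseMonoid (S : Type u) extends InverseMonoidWithZero S where
  boolIdem : BooleanAlgebra (Idem S)
  le_iff : ∀ e f : Idem S, e ≤ f ↔ e.val ≤ f.val
  exists_join : ∀ a b : S, Compatible a b → ∃ c, IsLUB {a, b} c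
  mul_join : ∀ a b c x : S, Compatible a b → IsLUB {a, b} c → IsLUB {x * a, x * b} (x * c)
  join_mul : ∀ a b c x : S, Compatible a b → IsLUB {a, b} c → IsLUB {a * x, b * x} (c * x)

namespace BooleanInverseMonoid

open InverseMonoidWithZero

instance instBooleanAlgebraIdem (S : Type u) [BooleanInverseMonoid S] : BooleanAlgebra (Idem S) :=
  boolIdem

section

variable {S : Type u} [BooleanInverseMonoid S]

/-- The extent `e(a) = d(a) ∨ r(a)`. -/
def extent (a : S) : Idem S := dom a ⊔ ran a

/-- `X^∨`: the set of all joins of finite compatible subsets of `X`. -/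
def joinClosure (X : Set S) : Set S :=
  {s | ∃ A : Finset S, (A : Set S) ⊆ X ∧ (A : Set S).Pairwise Compatible ∧ IsLUB (A : Set S) s}

/-- Two-sided semigroup ideals. -/
def IsIdeal (X : Set S) : Prop :=
  X.Nonempty ∧ ∀ x ∈ X, ∀ s : S, s * x ∈ X ∧ x * s ∈ X

/-- The special involution `a⁻¹ ∨ a ∨ (e(a))ᶜ` built from a non-zero `a` with `a² = 0`. -/
def IsSpecialInvolution (g : Sˣ) : Prop :=
  ∃ a : S, a ≠ 0 ∧ a * a = 0 ∧ IsLUB {a⁻¹, a, ((extent a)ᶜ).val} (g : S)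

end

variable (S : Type u) [BooleanInverseMonoid S]

/-- The only `∨`-closed ideals are `{0}` and `S`. -/
def IsZeroSimplifying : Prop :=
  ∀ X : Set S, IsIdeal X → joinClosure X = X → X = {0} ∨ X = Set.univ

/-- The only elements that commute with all idempotents are the idempotents. -/
def IsFundamental : Prop :=
  ∀ a : S, (∀ e : S, IsIdempotentElem e → a * e = e * a) → IsIdempotentElem a

/-- A Boolean inverse monoid is simple if it is fundamental and `0`-simplifying. -/
def IsSimple : Prop := IsFundamental S ∧ IsZeroSimplifying S

/-- The symmetric group `Sym(S)`: the subgroup of the units generated by special involutions. -/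
def Sym : Subgroup Sˣ := Subgroup.closure {g : Sˣ | IsSpecialInvolution g}

end BooleanInverseMonoid

/-- A Boolean inverse `∧`-monoid: every pair of elements has a meet. -/
class BooleanInverseMeetMonoid (S : Type u) extends BooleanInverseMonoid S where
  exists_meet : ∀ a b : S, ∃ c, IsGLB {a, b} c

namespace BooleanInverseMeetMonoid

open InverseMonoidWithZero BooleanInverseMonoid

variable {S : Type u} [BooleanInverseMeetMonoid S]

/-- The meet `a ∧ b`. -/
noncomputable def meet (a b : S) : S := (exists_meet a b).choose

theorem isGLB_meet (a b : S) : IsGLB {a, b} (meet a b) := (exists_meet a b).choose_spec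

/-- The fixed-point operator `φ(s) = s ∧ 1`. -/
noncomputable def fix (s : S) : Idem S :=
  ⟨meet s 1, idem_of_le_one ((isGLB_meet s 1).1 (by simp))⟩

/-- The support operator: `σ(s)` is the complement of `φ(s)` times `s⁻¹ s`. -/
noncomputable def supp (s : S) : Idem S :=
  ⟨((fix s)ᶜ).val * (s⁻¹ * s), idem_mul ((fix s)ᶜ).idem (idem_inv_mul s)⟩

end BooleanInverseMeetMonoid

/-- A Tarski monoid: a countably infinite Boolean inverse `∧`-monoid. -/
class TarskiMonoid (S : Type u) extends BooleanInverseMeetMonoid S where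
  countable : Countable S
  infinite : Infinite S

/-! The isomorphism is reconstructed from supports. For `t` with `t² = 1`, the elements whose
support lies below that of `t` are singled out by a formula in the language of groups
(`supp_le_supp_iff`), so `α` preserves and reflects this relation. Every idempotent is a finite join
of supports of such elements, hence `γ` must send the join of the supports of the `tᵢ` to the join
of the supports of the `α tᵢ`. `sup_supp_map_le` makes this well defined and monotone, `α⁻¹`
supplies the inverse, and equivariance follows from `supp_conj`.

This argument uses only the axioms of `InvolutionAction`. For a simple Tarski monoid they hold for
the following reasons. Fundamentality makes conjugation on idempotents faithful and identifies the
algebraic support with the dynamical one (`mul_eq_self_iff`). Special involutions cut an involution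
down to a piece `c ∨ tc` with `c` and `tc` disjoint. Being `0`-simplifying lets domains of elements
with range below any given nonzero idempotent cover everything (`domCover_of_isZeroSimplifying`);
since an infinite simple monoid has no atoms (`exists_split`), this writes each idempotent as a join
of supports (`exists_sup_supp`). -/

/-- A faithful action of a group on a Boolean algebra in which every group element has a support,
involutions can be cut down to invariant pieces, and every element is a finite join of supports of
involutions. -/
structure InvolutionAction (G A : Type*) [Group G] [BooleanAlgebra A] where
  act : G →* (A ≃o A)
  supp : G → A
  faithful : ∀ g, (∀ x, act g x = x) → g = 1
  supp_le_iff : ∀ g e, supp g ≤ e ↔ ∀ x, Disjoint x e → act g x = x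
  restrict : ∀ t c, t * t = 1 → Disjoint c (act t c) →
    ∃ u, supp u ≤ c ⊔ act t c ∧ ∀ x ≤ c ⊔ act t c, act u x = act t x
  exists_sup : ∀ e, ∃ F : Finset G, (∀ t ∈ F, t * t = 1) ∧ F.sup supp = e

/-- The elements of order at most two that commute with `t` and with all their own conjugates
under the centralizer of `t`. -/
def localInvolutions {G : Type*} [Group G] (t : G) : Set G :=
  {φ | φ * t = t * φ ∧ φ * φ = 1 ∧
    ∀ ψ, ψ * t = t * ψ → φ * (ψ * φ * ψ⁻¹) = ψ * φ * ψ⁻¹ * φ}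

/-- The centralizer of the squares of the centralizer of `localInvolutions t`. -/
def localGroup {G : Type*} [Group G] (t : G) : Set G :=
  {φ | ∀ ψ, (∀ χ ∈ localInvolutions t, ψ * χ = χ * ψ) → φ * (ψ * ψ) = ψ * ψ * φ}

theorem map_mem_localInvolutions {G H : Type*} [Group G] [Group H] (α : G ≃* H) {t g : G}
    (hg : g ∈ localInvolutions t) : α g ∈ localInvolutions (α t) := by
  obtain ⟨h1, h2, h3⟩ := hg
  refine ⟨by rw [← map_mul, h1, map_mul], by rw [← map_mul, h2, map_one], fun ψ hψ => ?_⟩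
  obtain ⟨ψ, rfl⟩ := α.surjective ψ
  have := h3 ψ (α.injective (by simpa using hψ))
  simpa using congrArg α this

theorem map_mem_localGroup {G H : Type*} [Group G] [Group H] (α : G ≃* H) {t g : G}
    (hg : g ∈ localGroup t) : α g ∈ localGroup (α t) := by
  intro ψ hψ
  obtain ⟨ψ, rfl⟩ := α.surjective ψ
  have := hg ψ fun χ hχ => α.injective (by simpa using hψ _ (map_mem_localInvolutions α hχ))
  simpa using congrArg α this

/-! ### Supports of group elements acting on a Boolean algebra. -/

namespace InvolutionAction

variable {G A : Type*} [Group G] [BooleanAlgebra A] (R : InvolutionAction G A)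

theorem act_mul (g h : G) (x : A) : R.act (g * h) x = R.act g (R.act h x) := by
  rw [map_mul]; rfl

theorem act_one (x : A) : R.act 1 x = x := by
  rw [map_one]; rfl

theorem act_inv_act (g : G) (x : A) : R.act g⁻¹ (R.act g x) = x := by
  rw [← act_mul, inv_mul_cancel, act_one]

theorem act_act_inv (g : G) (x : A) : R.act g (R.act g⁻¹ x) = x := by
  rw [← act_mul, mul_inv_cancel, act_one]

theorem ext {g h : G} (H : ∀ x, R.act g x = R.act h x) : g = h := by
  rw [← inv_mul_eq_one]
  refine R.faithful _ fun x => ?_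
  rw [act_mul, ← H, act_inv_act]

theorem disjoint_act {x y : A} (g : G) : Disjoint (R.act g x) (R.act g y) ↔ Disjoint x y :=
  disjoint_map_orderIso_iff (R.act g)

theorem act_le_act {x y : A} (g : G) : R.act g x ≤ R.act g y ↔ x ≤ y := (R.act g).le_iff_le

theorem act_eq_self {g : G} {x : A} (h : Disjoint x (R.supp g)) : R.act g x = x :=
  (R.supp_le_iff g _).1 le_rfl x h

theorem eq_one_of_supp {g : G} (h : R.supp g = ⊥) : g = 1 :=
  R.faithful g fun x => R.act_eq_self (by rw [h]; exact disjoint_bot_right)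

theorem supp_one : R.supp 1 = ⊥ :=
  le_bot_iff.1 <| (R.supp_le_iff 1 ⊥).2 fun x _ => R.act_one x

theorem ext_of_split (k : A) {g h : G} (h1 : ∀ x ≤ k, R.act g x = R.act h x)
    (h2 : ∀ x, Disjoint x k → R.act g x = R.act h x) : g = h := by
  refine R.ext fun x => ?_
  have : x = (x ⊓ k) ⊔ (x \ k) := sup_inf_sdiff x k |>.symm
  rw [this, map_sup, map_sup, h1 _ inf_le_right, h2 _ disjoint_sdiff_self_left]

theorem supp_conj (g h : G) : R.supp (g * h * g⁻¹) = R.act g (R.supp h) := by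
  have key : ∀ g h : G, R.supp (g * h * g⁻¹) ≤ R.act g (R.supp h) := fun g h => by
    refine (R.supp_le_iff _ _).2 fun x hx => ?_
    rw [act_mul, act_mul, R.act_eq_self (g := h), act_act_inv]
    rw [← R.disjoint_act g, act_act_inv]
    exact hx
  refine le_antisymm (key g h) ?_
  have := key g⁻¹ (g * h * g⁻¹)
  rw [show g⁻¹ * (g * h * g⁻¹) * g⁻¹⁻¹ = h by group] at this
  rw [← R.act_le_act g⁻¹, act_inv_act]
  exact this

theorem act_supp_of_commute {g h : G} (H : g * h = h * g) : R.act g (R.supp h) = R.supp h := by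
  rw [← supp_conj, H, mul_inv_cancel_right]

theorem act_supp_self (g : G) : R.act g (R.supp g) = R.supp g := R.act_supp_of_commute rfl

theorem supp_mul_le (g h : G) : R.supp (g * h) ≤ R.supp g ⊔ R.supp h := by
  refine (R.supp_le_iff _ _).2 fun x hx => ?_
  rw [disjoint_sup_right] at hx
  rw [act_mul, R.act_eq_self hx.2, R.act_eq_self hx.1]

/-- The part of `c` outside the support is fixed by `g`, hence disjoint from itself. -/
theorem le_supp_of_disjoint {g : G} {c : A} (h : Disjoint c (R.act g c)) : c ≤ R.supp g := by
  rw [← sdiff_eq_bot_iff, ← disjoint_self]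
  have h1 : R.act g (c \ R.supp g) = c \ R.supp g := R.act_eq_self disjoint_sdiff_self_left
  nth_rw 2 [← h1]
  exact h.mono sdiff_le (by rw [act_le_act]; exact sdiff_le)

theorem commute_of_disjoint {g h : G} (H : Disjoint (R.supp g) (R.supp h)) : g * h = h * g := by
  have hg : R.act h (R.supp g) = R.supp g := R.act_eq_self H
  refine R.ext_of_split (R.supp g) (fun x hx => ?_) fun x hx => ?_
  · rw [act_mul, act_mul, R.act_eq_self (H.mono_left hx), R.act_eq_self (g := h)]
    refine H.mono_left ?_
    rw [← R.act_supp_self g, act_le_act]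
    exact hx
  · rw [act_mul, act_mul, R.act_eq_self hx, R.act_eq_self (g := g)]
    rw [← hg, disjoint_act]
    exact hx

theorem exists_moved {g : G} {e : A} (h : ¬ R.supp g ≤ e) :
    ∃ c, c ≠ ⊥ ∧ Disjoint c e ∧ Disjoint c (R.act g c) := by
  rw [supp_le_iff] at h
  push Not at h
  obtain ⟨x, hx, hne⟩ := h
  -- If `x` is not fixed, then `x \ gx` or `x \ g⁻¹x` is nonzero, and either of them is disjoint
  -- from its image.
  by_cases h1 : x \ R.act g x = ⊥
  · refine ⟨x \ R.act g⁻¹ x, fun h2 => hne ?_, hx.mono_left sdiff_le, ?_⟩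
    · rw [sdiff_eq_bot_iff] at h1 h2
      rw [← R.act_le_act g, act_act_inv] at h2
      exact le_antisymm h2 h1
    · rw [map_sdiff, act_act_inv]
      exact disjoint_sdiff_self_right.mono_left sdiff_le
  · refine ⟨_, h1, hx.mono_left sdiff_le, disjoint_sdiff_self_left.mono_right ?_⟩
    rw [act_le_act]
    exact sdiff_le

theorem exists_involution {b : A} (hb : b ≠ ⊥) : ∃ t, t * t = 1 ∧ t ≠ 1 ∧ R.supp t ≤ b := by
  obtain ⟨F, hF, rfl⟩ := R.exists_sup b
  obtain ⟨t, ht, hne⟩ : ∃ t ∈ F, R.supp t ≠ ⊥ := by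
    by_contra! h
    exact hb (Finset.sup_eq_bot_iff _ _ |>.2 h)
  exact ⟨t, hF t ht, fun h => hne (by rw [h, supp_one]), Finset.le_sup ht⟩

theorem eq_one_of_eq_of_disjoint {g h : G} (H : g = h) (hd : Disjoint (R.supp g) (R.supp h)) :
    g = 1 := by
  subst H
  exact R.eq_one_of_supp (disjoint_self.1 hd)

/-- Take involutions `t` below `b` and `r` below some `c` that `t` moves off itself. If `(rt)² = 1`
then `r = trt⁻¹`, although these two have disjoint supports. -/
theorem exists_sq_ne_one {b : A} (hb : b ≠ ⊥) : ∃ g, R.supp g ≤ b ∧ g * g ≠ 1 := by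
  obtain ⟨t, ht, hne, hle⟩ := R.exists_involution hb
  obtain ⟨c, hc, -, hd⟩ := R.exists_moved (g := t) (e := ⊥)
    fun h => hne (R.eq_one_of_supp (le_bot_iff.1 h))
  obtain ⟨r, hr, hrne, hrle⟩ := R.exists_involution hc
  refine ⟨r * t, (R.supp_mul_le r t).trans
    (sup_le (hrle.trans ((R.le_supp_of_disjoint hd).trans hle)) hle), fun h => hrne ?_⟩
  have ht' : t⁻¹ = t := inv_eq_of_mul_eq_one_left ht
  have hr' : r⁻¹ = r := inv_eq_of_mul_eq_one_left hr
  refine R.eq_one_of_eq_of_disjoint (h := t * r * t⁻¹) ?_ ?_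
  · rw [ht', ← inv_eq_of_mul_eq_one_right (a := r) (b := t * r * t) (by rw [← h]; group), hr']
  · rw [supp_conj]
    exact hd.mono hrle (by rw [act_le_act]; exact hrle)

/-! ### Group-theoretic description of the elements supported below an involution. -/

/-- If `φ` moved some `c` outside the support of `t` off itself, an element `ψ` below `c` with `ψ² ≠
1` would commute with `t`, and the conjugation condition for this `ψ` fails. -/
theorem supp_le_of_mem_localInvolutions {t φ : G} (h : φ ∈ localInvolutions t) :
    R.supp φ ≤ R.supp t := by
  by_contra hn
  obtain ⟨hc, hsq, hconj⟩ := h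
  obtain ⟨c, hc0, hct, hcφ⟩ := R.exists_moved hn
  obtain ⟨ψ, hψ, hψ2⟩ := R.exists_sq_ne_one hc0
  have hψt : ψ * t = t * ψ := R.commute_of_disjoint (hct.mono_left hψ)
  have h1 := hconj ψ hψt
  have hθ : R.supp (φ * ψ * φ⁻¹) ≤ R.act φ c := by
    rw [supp_conj, act_le_act]
    exact hψ
  have hφ : φ⁻¹ = φ := inv_eq_of_mul_eq_one_left hsq
  have hcomm : ψ * (φ * ψ * φ⁻¹) = φ * ψ * φ⁻¹ * ψ :=
    R.commute_of_disjoint (hcφ.mono hψ hθ)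
  apply hψ2
  -- Put `θ = φψφ⁻¹`. As `φ² = 1`, commutation of `φ` with `ψφψ⁻¹` reads `θψ⁻¹ = ψθ⁻¹`; since `ψ`
  -- and `θ` commute, `ψ² = θ²`, with disjoint supports.
  refine R.eq_one_of_eq_of_disjoint (h := (φ * ψ * φ⁻¹) * (φ * ψ * φ⁻¹)) ?_ ?_
  · have h2 : φ * ψ * φ⁻¹ * ψ⁻¹ = ψ * (φ * ψ * φ⁻¹)⁻¹ := by
      calc φ * ψ * φ⁻¹ * ψ⁻¹ = φ * (ψ * φ * ψ⁻¹) := by rw [hφ]; simp only [mul_assoc]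
        _ = ψ * φ * ψ⁻¹ * φ := h1
        _ = ψ * (φ * ψ * φ⁻¹)⁻¹ := by rw [mul_inv_rev, mul_inv_rev, inv_inv, hφ, ← mul_assoc,
                                        ← mul_assoc]
    generalize φ * ψ * φ⁻¹ = θ at *
    rw [mul_inv_eq_iff_eq_mul] at h2
    calc ψ * ψ = ψ * θ⁻¹ * (θ * ψ) := by group
      _ = ψ * θ⁻¹ * ψ * θ := by rw [← hcomm, mul_assoc, mul_assoc, mul_assoc]
      _ = θ * θ := by rw [← h2]
  · exact hcφ.mono ((R.supp_mul_le _ _).trans (sup_le hψ hψ))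
      ((R.supp_mul_le _ _).trans (sup_le hθ hθ))

/-- On each of the four pieces cut out by the `t`-invariant elements `c` and `d`, both `g` and `h`
act as `t` or as the identity. -/
theorem commute_of_agree {t g h : G} {c d : A} (hc : R.act t c = c) (hd : R.act t d = d)
    (hg : R.supp g ≤ c) (hgc : ∀ x ≤ c, R.act g x = R.act t x)
    (hh : R.supp h ≤ d) (hhd : ∀ x ≤ d, R.act h x = R.act t x) : g * h = h * g := by
  have inv : ∀ {x k : A}, R.act t k = k → x ≤ k → R.act t x ≤ k := fun {x k} hk hx => by
    rw [← hk, act_le_act]; exact hx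
  have dis : ∀ {x k : A}, R.act t k = k → Disjoint x k → Disjoint (R.act t x) k :=
    fun {x k} hk hx => by rw [← hk, disjoint_act]; exact hx
  refine R.ext fun x => ?_
  rw [act_mul, act_mul]
  have h1 : ∀ x ≤ d, R.act g (R.act h x) = R.act h (R.act g x) := fun x hx => by
    have hxe : x = (x ⊓ c) ⊔ (x \ c) := sup_inf_sdiff x c |>.symm
    rw [hxe]
    simp only [map_sup]
    have hx1 : x ⊓ c ≤ d := inf_le_left.trans hx
    have hx2 : x \ c ≤ d := sdiff_le.trans hx
    have hx3 : Disjoint (x \ c) c := disjoint_sdiff_self_left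
    rw [hhd _ hx1, hgc _ inf_le_right, hgc _ (inv hc inf_le_right), hhd _ (inv hd hx1),
      hhd _ hx2, R.act_eq_self (hx3.mono_right hg), R.act_eq_self ((dis hc hx3).mono_right hg),
      hhd _ hx2]
  have h2 : ∀ x, Disjoint x d → R.act g (R.act h x) = R.act h (R.act g x) := fun x hx => by
    have hxe : x = (x ⊓ c) ⊔ (x \ c) := sup_inf_sdiff x c |>.symm
    rw [R.act_eq_self (hx.mono_right hh), hxe]
    simp only [map_sup]
    have hx1 : Disjoint (x ⊓ c) d := hx.mono_left inf_le_left
    have hx2 : Disjoint (x \ c) d := hx.mono_left sdiff_le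
    have hx3 : Disjoint (x \ c) c := disjoint_sdiff_self_left
    rw [hgc _ inf_le_right, R.act_eq_self (hx3.mono_right hg),
      R.act_eq_self ((dis hd hx1).mono_right hh), R.act_eq_self (hx2.mono_right hh)]
  have hxe : x = (x ⊓ d) ⊔ (x \ d) := sup_inf_sdiff x d |>.symm
  rw [hxe]
  simp only [map_sup]
  rw [h1 _ inf_le_right, h2 _ disjoint_sdiff_self_left]

/-- Conjugating the restriction of `t` to `c` by an element `ψ` of the centralizer of `t` gives the
restriction of `t` to `ψc`, and restrictions of `t` commute. -/
theorem restrict_mem_localInvolutions {t u : G} {c : A} (ht : t * t = 1) (hc : R.act t c = c)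
    (hu : R.supp u ≤ c) (huc : ∀ x ≤ c, R.act u x = R.act t x) : u ∈ localInvolutions t := by
  have htt : ∀ x, R.act t (R.act t x) = x := fun x => by rw [← act_mul, ht, act_one]
  have inv : ∀ {x : A}, x ≤ c → R.act t x ≤ c := fun {x} hx => by
    rw [← hc, act_le_act]; exact hx
  refine ⟨?_, ?_, fun ψ hψ => ?_⟩
  · exact R.commute_of_agree hc (by simp) hu huc (le_top (a := R.supp t)) fun _ _ => rfl
  · refine R.ext_of_split c (fun x hx => ?_) fun x hx => ?_
    · rw [act_mul, act_one, huc x hx, huc _ (inv hx), htt]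
    · rw [act_mul, act_one, R.act_eq_self (hx.mono_right hu), R.act_eq_self (hx.mono_right hu)]
  · have hcom : ∀ x, R.act t (R.act ψ x) = R.act ψ (R.act t x) := fun x => by
      rw [← act_mul, ← act_mul, hψ]
    refine R.commute_of_agree hc (d := R.act ψ c) ?_ hu huc ?_ ?_
    · rw [hcom, hc]
    · rw [supp_conj, act_le_act]
      exact hu
    · intro x hx
      rw [← R.act_le_act ψ⁻¹, act_inv_act] at hx
      rw [act_mul, act_mul, huc _ hx, ← hcom, act_act_inv]

/-- Below the support of `t`, commuting with all restrictions of `t` forces `χ` to preserve small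
`t`-orbits `x ∨ tx`. Thus `χ` acts locally as the identity or as `t`, and its square acts trivially
there. -/
theorem supp_sq_disjoint {t χ : G} (ht : t * t = 1)
    (hχ : ∀ u ∈ localInvolutions t, χ * u = u * χ) : Disjoint (R.supp (χ * χ)) (R.supp t) := by
  have htt : ∀ x, R.act t (R.act t x) = x := fun x => by rw [← act_mul, ht, act_one]
  rw [← le_compl_iff_disjoint_right]
  by_contra hn
  obtain ⟨d, hd0, hdt, hd⟩ := R.exists_moved hn
  have hdt : d ≤ R.supp t := by simpa using le_compl_iff_disjoint_right.2 hdt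
  obtain ⟨c, hc0, hcd, hct⟩ : ∃ c, c ≠ ⊥ ∧ c ≤ d ∧ Disjoint c (R.act t c) := by
    have h1 : ¬ R.supp t ≤ dᶜ := fun h =>
      hd0 (disjoint_self.1 ((le_compl_iff_disjoint_right.1 h).mono_left hdt))
    obtain ⟨c, h1, h2, h3⟩ := R.exists_moved h1
    exact ⟨c, h1, by simpa using le_compl_iff_disjoint_right.2 h2, h3⟩
  have htχ : t * χ = χ * t :=
    (hχ t ⟨rfl, ht, fun ψ hψ => by rw [hψ, mul_inv_cancel_right]⟩).symm
  have hpres : ∀ x ≤ c, R.act χ x ≤ x ⊔ R.act t x := by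
    intro x hx
    have hxt : Disjoint x (R.act t x) := hct.mono hx (by rw [act_le_act]; exact hx)
    have hinv : R.act t (x ⊔ R.act t x) = x ⊔ R.act t x := by
      rw [map_sup, htt, sup_comm]
    obtain ⟨u, hu, hux⟩ := R.restrict t x ht hxt
    have hcu := hχ u (R.restrict_mem_localInvolutions ht hinv hu hux)
    have hxu : x ≤ R.supp u :=
      R.le_supp_of_disjoint (by rw [hux x le_sup_left]; exact hxt)
    calc R.act χ x ≤ R.act χ (R.supp u) := by rw [act_le_act]; exact hxu
      _ = R.supp u := R.act_supp_of_commute hcu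
      _ ≤ _ := hu
  -- `χ²` moves `d`, hence every part of `c`, off `d`; it remains to find a nonzero part of `c` that
  -- `χ²` keeps inside `c`.
  have hfin : ∀ x ≤ c, x ≠ ⊥ → ¬ R.act χ (R.act χ x) ≤ c := by
    intro x hx hx0 hle
    have h1 : Disjoint (R.act χ (R.act χ x)) (R.act χ (R.act χ x)) := by
      refine hd.mono (hle.trans hcd) ?_
      rw [← act_mul, act_le_act]
      exact hx.trans hcd
    rw [disjoint_act, disjoint_act, disjoint_self] at h1
    exact hx0 h1
  -- If `χc` misses `c`, then `χ` carries `c` into `tc` and `χ²` carries `c` into `c`. Otherwise `χ`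
  -- maps the nonzero part `c ∧ χ⁻¹c` into itself.
  by_cases h : Disjoint (R.act χ c) c
  · have h1 : R.act χ c ≤ R.act t c :=
      Disjoint.left_le_of_le_sup_left (hpres c le_rfl) h
    refine hfin c le_rfl hc0 ?_
    calc R.act χ (R.act χ c) ≤ R.act χ (R.act t c) := by rw [act_le_act]; exact h1
      _ = R.act t (R.act χ c) := by rw [← act_mul, ← act_mul, htχ]
      _ ≤ R.act t (R.act t c) := by rw [act_le_act]; exact h1
      _ = c := htt c
  · have hx0 : c ⊓ R.act χ⁻¹ c ≠ ⊥ := fun h0 => h <| by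
      rw [← R.disjoint_act χ⁻¹, act_inv_act, disjoint_iff]
      exact h0
    have hx : c ⊓ R.act χ⁻¹ c ≤ c := inf_le_left
    have hχx : R.act χ (c ⊓ R.act χ⁻¹ c) ≤ c := by
      rw [map_inf, act_act_inv]; exact inf_le_right
    have h1 : R.act χ (c ⊓ R.act χ⁻¹ c) ≤ c ⊓ R.act χ⁻¹ c := by
      refine Disjoint.left_le_of_le_sup_right (hpres _ hx) ?_
      exact hct.mono hχx (by rw [act_le_act]; exact hx)
    refine hfin _ hx hx0 (le_trans ?_ hχx)
    rw [act_le_act]; exact h1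

/-- The elements supported below an involution are characterized inside the group. -/
theorem supp_le_supp_iff {t : G} (ht : t * t = 1) (g : G) :
    R.supp g ≤ R.supp t ↔ g ∈ localGroup t := by
  constructor
  · intro h ψ hψ
    exact R.commute_of_disjoint ((R.supp_sq_disjoint ht hψ).symm.mono_left h)
  · intro h
    by_contra hn
    obtain ⟨c, hc0, hct, hcg⟩ := R.exists_moved hn
    -- This `ψ` lives off the support of `t`, so it commutes with all local involutions; but `g`
    -- moves the support of `ψ²` off itself and cannot commute with `ψ²`.
    obtain ⟨ψ, hψ, hψ2⟩ := R.exists_sq_ne_one hc0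
    have h1 := h ψ fun χ hχ => R.commute_of_disjoint
      (hct.mono hψ (R.supp_le_of_mem_localInvolutions hχ))
    have hs : R.supp (ψ * ψ) ≤ c := (R.supp_mul_le _ _).trans (sup_le hψ hψ)
    refine hψ2 (R.eq_one_of_eq_of_disjoint (h := g * (ψ * ψ) * g⁻¹) ?_ ?_)
    · rw [h1, mul_inv_cancel_right]
    · rw [supp_conj]
      exact hcg.mono hs (by rw [act_le_act]; exact hs)

/-! ### Reconstruction of the Boolean algebra from the group. -/

section Iso

variable {R} {H B : Type*} [Group H] [BooleanAlgebra B] {Q : InvolutionAction H B} (α : G ≃* H)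

theorem supp_map_le_supp_map {t g : G} (ht : t * t = 1) (h : R.supp g ≤ R.supp t) :
    Q.supp (α g) ≤ Q.supp (α t) :=
  (Q.supp_le_supp_iff (by rw [← map_mul, ht, map_one]) _).2
    (map_mem_localGroup α ((R.supp_le_supp_iff ht g).1 h))

theorem supp_le_of_supp_map_le {t g : G} (ht : t * t = 1) (h : Q.supp (α g) ≤ Q.supp (α t)) :
    R.supp g ≤ R.supp t := by
  have := supp_map_le_supp_map (R := Q) (Q := R) α.symm
    (by rw [← map_mul, ht, map_one]) h
  simpa using this

/-- A failure leaves room for an involution `α v` in the difference. Pulled back, `v` meets the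
support of some `t'` in `F'`; an involution `w` below both has an image whose support is disjoint
from itself. -/
theorem sup_supp_map_le {F F' : Finset G} (hF : ∀ t ∈ F, t * t = 1) (hF' : ∀ t ∈ F', t * t = 1)
    (h : F.sup R.supp ≤ F'.sup R.supp) :
    (F.sup fun t => Q.supp (α t)) ≤ F'.sup fun t => Q.supp (α t) := by
  refine Finset.sup_le fun t ht => ?_
  by_contra hn
  rw [← sdiff_eq_bot_iff] at hn
  obtain ⟨u, hu2, hu1, hu⟩ := Q.exists_involution hn
  obtain ⟨v, rfl⟩ := α.surjective u
  have hv2 : v * v = 1 := α.injective (by simpa using hu2)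
  have hvt : R.supp v ≤ F'.sup R.supp :=
    ((supp_le_of_supp_map_le (Q := Q) α (hF t ht) (hu.trans sdiff_le)).trans
      (Finset.le_sup ht)).trans h
  have hv0 : R.supp v ≠ ⊥ := fun h0 => hu1 (by rw [R.eq_one_of_supp h0, map_one])
  obtain ⟨t', ht', hne⟩ : ∃ t' ∈ F', R.supp v ⊓ R.supp t' ≠ ⊥ := by
    by_contra! h0
    apply hv0
    rw [← inf_eq_left.2 hvt, Finset.sup_inf_distrib_left, Finset.sup_eq_bot_iff]
    exact h0
  obtain ⟨w, hw2, hw1, hw⟩ := R.exists_involution hne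
  have hwv : Q.supp (α w) ≤ Q.supp (α v) := supp_map_le_supp_map α hv2 (hw.trans inf_le_left)
  have hwt : Q.supp (α w) ≤ Q.supp (α t') :=
    supp_map_le_supp_map α (hF' t' ht') (hw.trans inf_le_right)
  have hd : Disjoint (Q.supp (α w)) (Q.supp (α w)) :=
    disjoint_sdiff_self_left.mono (hwv.trans hu)
      (hwt.trans (Finset.le_sup (f := fun t => Q.supp (α t)) ht'))
  exact hw1 (α.injective (by rw [Q.eq_one_of_supp (disjoint_self.1 hd), map_one]))

theorem exists_map_sup : ∃ f : A → B, Monotone f ∧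
    ∀ F : Finset G, (∀ t ∈ F, t * t = 1) → f (F.sup R.supp) = F.sup fun t => Q.supp (α t) := by
  choose F hF hFe using R.exists_sup
  refine ⟨fun e => (F e).sup fun t => Q.supp (α t), fun e e' h => ?_, fun F' hF' => ?_⟩
  · exact sup_supp_map_le (R := R) α (hF e) (hF e') (by rwa [hFe, hFe])
  · exact le_antisymm (sup_supp_map_le (R := R) α (hF _) hF' (hFe _).le)
      (sup_supp_map_le (R := R) α hF' (hF _) (hFe _).ge)

/-- An isomorphism of the groups is induced by an isomorphism of the Boolean algebras. -/
theorem exists_orderIso (R : InvolutionAction G A) (Q : InvolutionAction H B) (α : G ≃* H) :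
    ∃ γ : A ≃o B, (∀ t : G, t * t = 1 → γ (R.supp t) = Q.supp (α t)) ∧
      ∀ g e, γ (R.act g e) = Q.act (α g) (γ e) := by
  obtain ⟨f, hfm, hf⟩ := exists_map_sup (R := R) (Q := Q) α
  obtain ⟨f', hfm', hf'⟩ := exists_map_sup (R := Q) (Q := R) α.symm
  have key : ∀ e, f' (f e) = e := fun e => by
    obtain ⟨F, hF, rfl⟩ := R.exists_sup e
    have h1 := hf' (F.map α.toEquiv.toEmbedding) (by
      simp only [Finset.mem_map_equiv]
      intro t ht
      have := hF _ ht
      apply α.symm.injective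
      simpa using this)
    rw [hf F hF]
    simp only [Finset.sup_map, Function.comp_def] at h1
    simpa using h1
  have key' : ∀ e, f (f' e) = e := fun e => by
    obtain ⟨F, hF, rfl⟩ := Q.exists_sup e
    have h1 := hf (F.map α.symm.toEquiv.toEmbedding) (by
      simp only [Finset.mem_map_equiv]
      intro t ht
      have := hF _ ht
      apply α.injective
      simpa using this)
    rw [hf' F hF]
    simp only [Finset.sup_map, Function.comp_def] at h1
    simpa using h1
  let γ : A ≃o B :=
    { toFun := f, invFun := f', left_inv := key, right_inv := key'
      map_rel_iff' := fun {a b} => ⟨fun h => by simpa [key] using hfm' h, fun h => hfm h⟩ }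
  refine ⟨γ, fun t ht => ?_, fun g e => ?_⟩
  · have := hf {t} (by simpa using ht)
    rwa [Finset.sup_singleton, Finset.sup_singleton] at this
  · obtain ⟨F, hF, rfl⟩ := R.exists_sup e
    -- Conjugating the family by `g` translates its join of supports by `g`.
    have h1 := hf (F.map (MulAut.conj g).toEquiv.toEmbedding) (by
      intro t ht
      obtain ⟨s, hs, rfl⟩ := Finset.mem_map.1 ht
      have h2 : s * s = 1 := hF s hs
      simp [h2])
    simp only [Finset.sup_map, Function.comp_def] at h1
    change f _ = Q.act (α g) (f _)
    rw [hf F hF, map_finset_sup, map_finset_sup]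
    simp only [Function.comp_def]
    simpa [supp_conj] using h1

end Iso

end InvolutionAction
-- Inverse monoids and the Munn action.
namespace InverseMonoidWithZero

section

variable {S : Type*} [InverseMonoidWithZero S]

theorem inv_inv_eq (s : S) : s⁻¹⁻¹ = s :=
  (inv_unique s⁻¹ s (inv_mul_inv_self s) (mul_inv_mul_self s)).symm

theorem inv_of_idem {e : S} (he : IsIdempotentElem e) : e⁻¹ = e :=
  (inv_unique e e (by rw [he.eq, he.eq]) (by rw [he.eq, he.eq])).symm

theorem inv_mul_eq (s t : S) : (s * t)⁻¹ = t⁻¹ * s⁻¹ := by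
  have h := idem_comm (idem_inv_mul s) (idem_mul_inv t)
  refine (inv_unique _ _ ?_ ?_).symm
  · calc s * t * (t⁻¹ * s⁻¹) * (s * t) = s * ((t * t⁻¹) * (s⁻¹ * s)) * t := by
          simp only [mul_assoc]
      _ = (s * s⁻¹ * s) * (t * t⁻¹ * t) := by rw [← h]; simp only [mul_assoc]
      _ = s * t := by rw [mul_inv_mul_self, mul_inv_mul_self]
  · calc t⁻¹ * s⁻¹ * (s * t) * (t⁻¹ * s⁻¹) = t⁻¹ * ((s⁻¹ * s) * (t * t⁻¹)) * s⁻¹ := by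
          simp only [mul_assoc]
      _ = (t⁻¹ * t * t⁻¹) * (s⁻¹ * s * s⁻¹) := by rw [h]; simp only [mul_assoc]
      _ = t⁻¹ * s⁻¹ := by rw [inv_mul_inv_self, inv_mul_inv_self]

theorem units_inv (g : Sˣ) : ((g⁻¹ : Sˣ) : S) = (g : S)⁻¹ :=
  inv_unique _ _ (by simp) (by simp)

theorem le_def (a b : S) : a ≤ b ↔ a = b * a⁻¹ * a := Iff.rfl

theorem mul_idem_le (b : S) {e : S} (he : IsIdempotentElem e) : b * e ≤ b := by
  rw [le_def, inv_mul_eq, inv_of_idem he]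
  have h := idem_comm (idem_inv_mul b) he
  calc b * e = b * b⁻¹ * b * (e * e) := by rw [mul_inv_mul_self, he.eq]
    _ = b * ((b⁻¹ * b) * e) * e := by simp only [mul_assoc]
    _ = b * (e * b⁻¹) * (b * e) := by rw [h]; simp only [mul_assoc]

theorem idem_le_iff {e : S} (he : IsIdempotentElem e) (b : S) : e ≤ b ↔ b * e = e := by
  rw [le_def, inv_of_idem he, mul_assoc, he.eq, eq_comm]

theorem zero_le_all (s : S) : 0 ≤ s := by rw [le_def, mul_zero]

theorem idem_conj (a : S) {e : S} (he : IsIdempotentElem e) : IsIdempotentElem (a * e * a⁻¹) := by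
  have h := idem_comm (idem_inv_mul a) he
  calc a * e * a⁻¹ * (a * e * a⁻¹) = a * (e * ((a⁻¹ * a) * e)) * a⁻¹ := by
        simp only [mul_assoc]
    _ = a * (e * e) * (a⁻¹ * a * a⁻¹) := by rw [h]; simp only [mul_assoc]
    _ = a * e * a⁻¹ := by rw [he.eq, inv_mul_inv_self]

theorem idem_zero : IsIdempotentElem (0 : S) := mul_zero 0

theorem compatible_idem {e f : S} (he : IsIdempotentElem e) (hf : IsIdempotentElem f) :
    Compatible e f :=
  ⟨by rw [inv_of_idem he]; exact idem_mul he hf, by rw [inv_of_idem hf]; exact idem_mul he hf⟩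

/-- The Munn action `e ↦ a e a⁻¹` of an element on the idempotents. -/
def munn (a : S) (e : Idem S) : Idem S := ⟨a * e.val * a⁻¹, idem_conj a e.idem⟩

theorem Idem.ext {e f : Idem S} (h : e.val = f.val) : e = f := by
  cases e; cases f; congr

theorem conj_eq_munn (g : Sˣ) (e : Idem S) : conj g e = munn (g : S) e :=
  Idem.ext (by simp only [conj, munn, units_inv])

theorem munn_mul (a b : S) (e : Idem S) : munn (a * b) e = munn a (munn b e) :=
  Idem.ext (by simp only [munn, inv_mul_eq, mul_assoc])

theorem ran_mul (a b : S) : ran (a * b) = munn a (ran b) :=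
  Idem.ext (by simp only [munn, ran, inv_mul_eq, mul_assoc])

theorem dom_mul (a b : S) : dom (a * b) = munn b⁻¹ (dom a) :=
  Idem.ext (by simp only [munn, dom, inv_mul_eq, inv_inv_eq, mul_assoc])

theorem dom_inv (a : S) : dom a⁻¹ = ran a :=
  Idem.ext (by simp only [ran, dom, inv_inv_eq])

theorem mul_dom (a : S) : a * (dom a).val = a := by
  rw [dom, ← mul_assoc, mul_inv_mul_self]

theorem ran_mul_self (a : S) : (ran a).val * a = a := mul_inv_mul_self a

end

end InverseMonoidWithZero

/-! ### Boolean inverse monoids: joins, swaps and the action of the units. -/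

namespace BooleanInverseMonoid

open InverseMonoidWithZero

section

variable {S : Type*} [BooleanInverseMonoid S]

theorem idem_le_iff_mul {e f : Idem S} : e ≤ f ↔ f.val * e.val = e.val := by
  rw [le_iff, idem_le_iff e.idem]

theorem idem_le_iff_mul' {e f : Idem S} : e ≤ f ↔ e.val * f.val = e.val := by
  rw [idem_le_iff_mul, idem_comm f.idem e.idem]

theorem val_inf (e f : Idem S) : (e ⊓ f).val = e.val * f.val := by
  have h : e ⊓ f = ⟨e.val * f.val, idem_mul e.idem f.idem⟩ := by
    refine le_antisymm ?_ (le_inf ?_ ?_)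
    · have h1 := idem_le_iff_mul'.1 (inf_le_left : e ⊓ f ≤ e)
      have h2 := idem_le_iff_mul'.1 (inf_le_right : e ⊓ f ≤ f)
      rw [idem_le_iff_mul', ← mul_assoc, h1, h2]
    · rw [idem_le_iff_mul, ← mul_assoc, e.idem.eq]
    · rw [idem_le_iff_mul', mul_assoc, f.idem.eq]
  rw [h]

theorem val_bot : (⊥ : Idem S).val = 0 := by
  have h : (⊥ : Idem S) = ⟨0, idem_zero⟩ :=
    le_antisymm bot_le (idem_le_iff_mul.2 (by simp))
  rw [h]

theorem val_top : (⊤ : Idem S).val = 1 := by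
  have h : (⊤ : Idem S) = ⟨1, mul_one 1⟩ :=
    le_antisymm (idem_le_iff_mul.2 (by simp)) le_top
  rw [h]

theorem disjoint_iff_mul {e f : Idem S} : Disjoint e f ↔ e.val * f.val = 0 := by
  rw [disjoint_iff, ← val_inf]
  exact ⟨fun h => by rw [h, val_bot], fun h => Idem.ext (by rw [h, val_bot])⟩

/-- A join taken in `S` lies below `1`, so it is idempotent and agrees with the Boolean join. -/
theorem isLUB_sup (e f : Idem S) : IsLUB {e.val, f.val} (e ⊔ f).val := by
  obtain ⟨c, hc⟩ := exists_join _ _ (compatible_idem e.idem f.idem)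
  have h1 : c ≤ (e ⊔ f).val := hc.2 (by
    rintro _ (rfl | rfl)
    · exact (le_iff _ _).1 le_sup_left
    · exact (le_iff _ _).1 le_sup_right)
  have h2 : IsIdempotentElem c := by
    refine idem_of_le_one (h1.trans ?_)
    rw [← val_top]
    exact (le_iff _ _).1 le_top
  have h3 : e ⊔ f ≤ ⟨c, h2⟩ := sup_le ((le_iff _ _).2 (hc.1 (by simp)))
    ((le_iff _ _).2 (hc.1 (by simp)))
  rwa [le_antisymm ((le_iff _ _).1 h3) h1]

theorem munn_mono (a : S) {e f : Idem S} (h : e ≤ f) : munn a e ≤ munn a f := by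
  rw [idem_le_iff_mul] at h ⊢
  have hc := idem_comm (idem_inv_mul a) e.idem
  calc a * f.val * a⁻¹ * (a * e.val * a⁻¹) = a * (f.val * ((a⁻¹ * a) * e.val)) * a⁻¹ := by
        simp only [mul_assoc]
    _ = a * (f.val * e.val) * (a⁻¹ * a * a⁻¹) := by rw [hc]; simp only [mul_assoc]
    _ = a * e.val * a⁻¹ := by rw [h, inv_mul_inv_self]

theorem munn_inv_munn (a : S) (e : Idem S) : munn a⁻¹ (munn a e) = e ⊓ dom a := by
  apply Idem.ext
  rw [val_inf]
  have hc := idem_comm (idem_inv_mul a) e.idem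
  simp only [munn, dom, inv_inv_eq]
  calc a⁻¹ * (a * e.val * a⁻¹) * a = ((a⁻¹ * a) * e.val) * (a⁻¹ * a) := by simp only [mul_assoc]
    _ = e.val * ((a⁻¹ * a) * (a⁻¹ * a)) := by rw [hc, mul_assoc]
    _ = _ := by rw [(idem_inv_mul a).eq]

theorem munn_munn_inv (a : S) (e : Idem S) : munn a (munn a⁻¹ e) = e ⊓ ran a := by
  have := munn_inv_munn a⁻¹ e
  rwa [inv_inv_eq, dom_inv] at this

theorem munn_le_ran (a : S) (e : Idem S) : munn a e ≤ ran a := by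
  have h : munn a ⊤ = ran a := Idem.ext (by simp [munn, ran, val_top])
  rw [← h]
  exact munn_mono a le_top

theorem munn_dom (a : S) : munn a (dom a) = ran a :=
  Idem.ext (by simp only [munn, ran, mul_dom])

/-- The actions of `a` and `a⁻¹` are monotone and mutually inverse up to meets with `dom a` and `ran
a`, so joins are transported. -/
theorem munn_sup (a : S) (e f : Idem S) : munn a (e ⊔ f) = munn a e ⊔ munn a f := by
  refine le_antisymm ?_ (sup_le (munn_mono a le_sup_left) (munn_mono a le_sup_right))
  have key : ∀ x : Idem S, x ≤ e ⊔ f → x ⊓ dom a ≤ munn a⁻¹ (munn a e ⊔ munn a f) := by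
    intro x hx
    refine (inf_le_inf_right _ hx).trans ?_
    rw [inf_sup_right, ← munn_inv_munn, ← munn_inv_munn]
    exact sup_le (munn_mono _ le_sup_left) (munn_mono _ le_sup_right)
  have h := munn_mono a (key _ le_rfl)
  rw [munn_munn_inv, ← munn_inv_munn, munn_munn_inv] at h
  exact ((le_inf le_rfl (munn_le_ran a _)).trans h).trans inf_le_left

theorem munn_one (e : Idem S) : munn (1 : S) e = e :=
  Idem.ext (by simp [munn, inv_of_idem (S := S) (e := 1) (mul_one 1)])

theorem munn_mul_idem (a : S) {e f : Idem S} (h : f ≤ e) : munn (a * e.val) f = munn a f := by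
  rw [munn_mul]
  congr 1
  apply Idem.ext
  simp only [munn, inv_of_idem e.idem]
  rw [idem_le_iff_mul.1 h, idem_le_iff_mul'.1 h]

theorem dom_mul_idem (a : S) (e : Idem S) : dom (a * e.val) = dom a ⊓ e := by
  apply Idem.ext
  rw [val_inf]
  simp only [dom, inv_mul_eq, inv_of_idem e.idem]
  calc e.val * a⁻¹ * (a * e.val) = (e.val * (a⁻¹ * a)) * e.val := by simp only [mul_assoc]
    _ = _ := by rw [idem_comm e.idem (idem_inv_mul a), mul_assoc, e.idem.eq]

theorem sq_eq_zero_iff (a : S) : a * a = 0 ↔ Disjoint (dom a) (ran a) := by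
  rw [disjoint_iff_mul]
  constructor
  · intro h
    calc a⁻¹ * a * (a * a⁻¹) = a⁻¹ * (a * a) * a⁻¹ := by simp only [mul_assoc]
      _ = 0 := by rw [h, mul_zero, zero_mul]
  · intro h
    calc a * a = a * (dom a).val * ((ran a).val * a) := by rw [mul_dom, ran_mul_self]
      _ = a * ((dom a).val * (ran a).val) * a := by simp only [mul_assoc]
      _ = 0 := by rw [h, mul_zero, zero_mul]

theorem isLUB_unique_pair {a b : S} (h : IsLUB {a, 0} b) : b = a := by
  refine h.unique ⟨?_, fun x hx => hx (by simp)⟩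
  rintro _ (rfl | rfl)
  · exact le_rfl
  · exact zero_le_all _

theorem isLUB_unique_pair' {a b : S} (h : IsLUB {0, a} b) : b = a :=
  isLUB_unique_pair (by rwa [Set.pair_comm])

theorem inv_zero_eq : (0 : S)⁻¹ = 0 := inv_of_idem idem_zero

/-- An element of square zero gives a special involution exchanging its domain and its range. -/
theorem exists_swap {a : S} (ha : a * a = 0) : ∃ u : Sˣ, u * u = 1 ∧
    IsLUB {a⁻¹, a, ((extent a)ᶜ).val} (u : S) ∧ (u : S) * (dom a).val = a ∧
    (u : S) * (ran a).val = a⁻¹ ∧ (u : S) * ((extent a)ᶜ).val = ((extent a)ᶜ).val := by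
  have hi : a⁻¹ * a⁻¹ = 0 := by rw [← inv_mul_eq, ha, inv_zero_eq]
  have hcomp : Compatible a⁻¹ a :=
    ⟨by rw [inv_inv_eq, ha]; exact idem_zero, by rw [hi]; exact idem_zero⟩
  obtain ⟨c, hc⟩ := exists_join _ _ hcomp
  set f := (extent a)ᶜ with hf
  have hfd : (dom a).val * f.val = 0 :=
    disjoint_iff_mul.1 ((disjoint_compl_right).mono_left le_sup_left)
  have hfr : (ran a).val * f.val = 0 :=
    disjoint_iff_mul.1 ((disjoint_compl_right).mono_left le_sup_right)
  have haf : a * f.val = 0 := by rw [← mul_dom a, mul_assoc, hfd, mul_zero]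
  have haf' : a⁻¹ * f.val = 0 := by
    rw [← mul_dom a⁻¹, dom_inv, mul_assoc, hfr, mul_zero]
  have hfa : f.val * a = 0 := by
    rw [← ran_mul_self a, ← mul_assoc, idem_comm f.idem (ran a).idem, hfr, zero_mul]
  have hfa' : f.val * a⁻¹ = 0 := by
    rw [← ran_mul_self a⁻¹, ← dom_inv, inv_inv_eq, ← mul_assoc, idem_comm f.idem (dom a).idem,
      hfd, zero_mul]
  have hcf : c * f.val = 0 := by
    have := join_mul _ _ _ f.val hcomp hc
    rw [haf, haf'] at this
    exact isLUB_unique_pair this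
  have hfc : f.val * c = 0 := by
    have := mul_join _ _ _ f.val hcomp hc
    rw [hfa, hfa'] at this
    exact isLUB_unique_pair this
  have hca : c * a = (dom a).val := by
    have := join_mul _ _ _ a hcomp hc
    rw [ha] at this
    exact isLUB_unique_pair this
  have hca' : c * a⁻¹ = (ran a).val := by
    have := join_mul _ _ _ a⁻¹ hcomp hc
    rw [hi] at this
    exact isLUB_unique_pair' this
  have hcomp' : Compatible c f.val := by
    refine ⟨?_, by rw [inv_of_idem f.idem, hcf]; exact idem_zero⟩
    rw [show c⁻¹ * f.val = (f.val * c)⁻¹ by rw [inv_mul_eq, inv_of_idem f.idem], hfc, inv_zero_eq]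
    exact idem_zero
  obtain ⟨u, hu⟩ := exists_join _ _ hcomp'
  have hua : u * a = (dom a).val := by
    have := join_mul _ _ _ a hcomp' hu
    rw [hfa, hca] at this
    exact isLUB_unique_pair this
  have hua' : u * a⁻¹ = (ran a).val := by
    have := join_mul _ _ _ a⁻¹ hcomp' hu
    rw [hfa', hca'] at this
    exact isLUB_unique_pair this
  have huf : u * f.val = f.val := by
    have := join_mul _ _ _ f.val hcomp' hu
    rw [hcf, f.idem.eq] at this
    exact isLUB_unique_pair' this
  -- With `c = a⁻¹ ∨ a` and `u = c ∨ f`, multiplying out gives `uc = extent a` and `uf = f`, hence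
  -- `u² = extent a ∨ f = 1`.
  have huc : u * c = (extent a).val := by
    have := mul_join _ _ _ u hcomp hc
    rw [hua, hua', Set.pair_comm] at this
    exact this.unique (isLUB_sup _ _)
  have huu : u * u = 1 := by
    have := mul_join _ _ _ u hcomp' hu
    rw [huc, huf] at this
    rw [this.unique (isLUB_sup _ _), hf, sup_compl_eq_top, val_top]
  refine ⟨⟨u, u, huu, huu⟩, Units.ext huu, ⟨?_, fun x hx => hu.2 ?_⟩, ?_, ?_, huf⟩
  · rintro _ (rfl | rfl | rfl)
    · exact (hc.1 (by simp)).trans (hu.1 (by simp))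
    · exact (hc.1 (by simp)).trans (hu.1 (by simp))
    · exact hu.1 (by simp)
  · rintro _ (rfl | rfl)
    · exact hc.2 (by
        rintro _ (rfl | rfl)
        · exact hx (by simp)
        · exact hx (by simp))
    · exact hx (by simp)
  · change u * (dom a).val = a
    rw [← hua, ← mul_assoc, huu, one_mul]
  · change u * (ran a).val = a⁻¹
    rw [← hua', ← mul_assoc, huu, one_mul]

/-- The units act on the idempotents by order automorphisms. -/
def unitsAct : Sˣ →* (Idem S ≃o Idem S) where
  toFun g :=
    { toFun := conj g
      invFun := conj g⁻¹
      left_inv := fun e => by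
        rw [conj_eq_munn, conj_eq_munn, ← munn_mul, Units.inv_mul, munn_one]
      right_inv := fun e => by
        rw [conj_eq_munn, conj_eq_munn, ← munn_mul, Units.mul_inv, munn_one]
      map_rel_iff' := fun {e f} => by
        change conj g e ≤ conj g f ↔ e ≤ f
        refine ⟨fun h => ?_, fun h => by simpa only [conj_eq_munn] using munn_mono _ h⟩
        have := munn_mono ((g⁻¹ : Sˣ) : S) h
        rwa [conj_eq_munn, conj_eq_munn, ← munn_mul, ← munn_mul, Units.inv_mul, munn_one,
          munn_one] at this }
  map_one' := by
    ext e
    exact (conj_eq_munn _ _).trans (munn_one e)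
  map_mul' g h := by
    ext e
    change conj (g * h) e = conj g (conj h e)
    rw [conj_eq_munn, conj_eq_munn, conj_eq_munn, Units.val_mul, munn_mul]

theorem unitsAct_apply (g : Sˣ) (e : Idem S) : unitsAct g e = munn (g : S) e := conj_eq_munn g e

theorem munn_eq_munn_of_mul_eq {a b : S} {e f : Idem S} (h : a * e.val = b * e.val) (hf : f ≤ e) :
    munn a f = munn b f := by
  rw [← munn_mul_idem a hf, h, munn_mul_idem b hf]

/-- If `g` fixes everything below `e`, then `ge` commutes with all idempotents. Fundamentality makes
it idempotent, so it equals its own domain, which is `e`. -/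
theorem mul_eq_self_iff (hS : IsFundamental S) (g : Sˣ) (e : Idem S) :
    (g : S) * e.val = e.val ↔ ∀ x ≤ e, munn (g : S) x = x := by
  constructor
  · intro h x hx
    rw [munn_eq_munn_of_mul_eq (b := 1) (by rw [h, one_mul]) hx, munn_one]
  · intro h
    have hcomm : ∀ x ≤ e, (g : S) * x.val = x.val * g := fun x hx => by
      have h1 : (g : S) * x.val * (g : S)⁻¹ = x.val := congrArg Idem.val (h x hx)
      rw [← units_inv] at h1
      rw [← Units.mul_inv_eq_iff_eq_mul]
      exact h1
    have hid : IsIdempotentElem ((g : S) * e.val) := by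
      refine hS _ fun x hx => ?_
      have h1 := hcomm (e ⊓ ⟨x, hx⟩) inf_le_left
      rw [val_inf] at h1
      rw [mul_assoc, h1, hcomm e le_rfl, ← mul_assoc, idem_comm hx e.idem]
    have h1 : dom ((g : S) * e.val) = e := by
      rw [dom_mul_idem]
      refine inf_eq_right.2 (le_top.trans_eq (Idem.ext ?_))
      simp only [dom, val_top, ← units_inv, Units.inv_mul]
    have h2 : (dom ((g : S) * e.val)).val = (g : S) * e.val := by
      simp only [dom, inv_of_idem hid]
      exact hid
    rw [← h2, h1]

end

end BooleanInverseMonoid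
-- Covering by domains, and absence of atoms.
namespace BooleanInverseMonoid

open InverseMonoidWithZero

section

variable {S : Type*} [BooleanInverseMonoid S]

/-- The idempotents that are finite joins of domains of elements with range below `f`. -/
inductive DomCover (f : Idem S) : Idem S → Prop
  | dom (a : S) (h : ran a ≤ f) : DomCover f (dom a)
  | sup {e e' : Idem S} (h : DomCover f e) (h' : DomCover f e') : DomCover f (e ⊔ e')

theorem dom_zero : dom (0 : S) = ⊥ := Idem.ext (by simp [dom, val_bot])

theorem ran_zero : ran (0 : S) = ⊥ := Idem.ext (by simp [ran, val_bot])

theorem dom_idem (e : Idem S) : dom e.val = e :=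
  Idem.ext (by simp only [dom, inv_of_idem e.idem]; exact e.idem)

theorem ran_idem (e : Idem S) : ran e.val = e :=
  Idem.ext (by simp only [ran, inv_of_idem e.idem]; exact e.idem)

theorem ran_mul_le (a b : S) : ran (a * b) ≤ ran a := by
  rw [ran_mul]
  exact munn_le_ran a _

theorem dom_mul_le (a b : S) : dom (a * b) ≤ dom b := by
  rw [dom_mul, ← inv_inv_eq b, dom_inv, inv_inv_eq]
  exact munn_le_ran _ _

theorem munn_bot (a : S) : munn a ⊥ = ⊥ :=
  Idem.ext (by simp [munn, val_bot])

theorem DomCover.bot (f : Idem S) : DomCover f ⊥ := by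
  rw [← dom_zero]
  exact .dom 0 (by rw [ran_zero]; exact bot_le)

theorem DomCover.mono {f e x : Idem S} (h : DomCover f e) (hx : x ≤ e) : DomCover f x := by
  induction h generalizing x with
  | dom a ha =>
    rw [← inf_eq_right.2 hx, ← dom_mul_idem]
    exact .dom _ ((ran_mul_le _ _).trans ha)
  | sup _ _ ih ih' =>
    rw [← inf_eq_left.2 hx, inf_sup_left]
    exact .sup (ih inf_le_right) (ih' inf_le_right)

/-- Restricting `s` to the join of the domains still gives an upper bound of `A`, so the restriction
is `s` itself. -/
theorem dom_le_sup_dom {A : Finset S} {s : S} (h : IsLUB (A : Set S) s) :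
    dom s ≤ A.sup dom := by
  have h1 : s ≤ s * (A.sup dom).val := by
    refine h.2 fun a ha => ?_
    have h2 := idem_le_iff_mul.1 (Finset.le_sup (f := dom) (Finset.mem_coe.1 ha))
    rw [le_def, mul_assoc]
    change a = s * (A.sup dom).val * (dom a).val
    rw [mul_assoc, h2, dom, ← mul_assoc]
    exact h.1 ha
  have h3 := le_antisymm h1 (mul_idem_le s (A.sup dom).idem)
  rw [h3, dom_mul_idem]
  exact inf_le_right

theorem domCover_of_isZeroSimplifying (hS : IsZeroSimplifying S) {f : Idem S} (hf : f ≠ ⊥)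
    (e : Idem S) : DomCover f e := by
  -- Quantifying over `t` builds in closure under right multiplication; left multiplication only
  -- shrinks domains. As `X` is a join-closed ideal containing `f ≠ 0`, it is all of `S`.
  let X : Set S := {s | ∀ t, DomCover f (dom (s * t))}
  have hX : IsIdeal X := by
    refine ⟨⟨0, fun t => ?_⟩, fun x hx s => ⟨fun t => ?_, fun t => ?_⟩⟩
    · rw [zero_mul, dom_zero]
      exact .bot f
    · rw [mul_assoc]
      exact (hx t).mono (dom_mul_le _ _)
    · rw [mul_assoc]
      exact hx _
  have hXc : joinClosure X = X := by
    refine Set.Subset.antisymm ?_ fun s hs => ?_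
    · rintro s ⟨A, hA, -, hs⟩ t
      rw [dom_mul]
      refine DomCover.mono ?_ (munn_mono _ (dom_le_sup_dom hs))
      refine Finset.sup_induction (p := fun e => DomCover f (munn t⁻¹ e)) ?_ ?_ ?_
      · rw [munn_bot]
        exact .bot f
      · intro x hx y hy
        rw [munn_sup]
        exact .sup hx hy
      · intro a ha
        rw [← dom_mul]
        exact hA ha t
    · exact ⟨{s}, by simpa using hs, by simp, by simp⟩
  have hfX : f.val ∈ X := fun t => .dom _ ((ran_mul_le _ _).trans (ran_idem f).le)
  rcases hS X hX hXc with h | h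
  · rw [h] at hfX
    exact absurd (Idem.ext (by rw [val_bot]; exact hfX)) hf
  · have : e.val ∈ X := by rw [h]; trivial
    simpa [dom_idem] using this 1

/-- The Munn action is faithful: if `s` and `t` act alike, `t⁻¹s` commutes with all idempotents,
hence is idempotent, and `s ≤ t`; the converse inequality is symmetric. -/
theorem finite_of_finite_idem (hS : IsFundamental S) [Finite (Idem S)] : Finite S := by
  refine Finite.of_injective (munn : S → Idem S → Idem S) fun s t h => ?_
  have key : ∀ s t : S, (munn s = munn t) → s ≤ t := by
    intro s t h
    have hid : IsIdempotentElem (t⁻¹ * s) := by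
      refine hS _ fun e he => ?_
      have h1 : s * e * s⁻¹ = t * e * t⁻¹ := congrArg Idem.val (congrFun h ⟨e, he⟩)
      calc t⁻¹ * s * e = t⁻¹ * (s * s⁻¹ * s) * e := by rw [mul_inv_mul_self]
        _ = t⁻¹ * s * ((s⁻¹ * s) * e) := by simp only [mul_assoc]
        _ = t⁻¹ * (s * e * s⁻¹) * s := by
          rw [idem_comm (idem_inv_mul s) he]; simp only [mul_assoc]
        _ = (t⁻¹ * t) * e * t⁻¹ * s := by rw [h1]; simp only [mul_assoc]
        _ = e * (t⁻¹ * t * t⁻¹) * s := by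
          rw [idem_comm (idem_inv_mul t) he]; simp only [mul_assoc]
        _ = e * (t⁻¹ * s) := by rw [inv_mul_inv_self, mul_assoc]
    have h1 : s * s⁻¹ = t * t⁻¹ := by
      have := congrArg Idem.val (congrFun h ⊤)
      simpa [munn, val_top] using this
    have h2 : s = t * (t⁻¹ * s) := by rw [← mul_assoc, ← h1, mul_inv_mul_self]
    rw [h2]
    exact mul_idem_le t hid
  exact le_antisymm (key s t h) (key t s h.symm)

/-- If `e` were an atom, each domain of an element with range below `e` would have at most two
idempotents below it. Finitely many such domains cover `1`, making the idempotents, and then `S`,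
finite. -/
theorem exists_split [Infinite S] (hS : IsSimple S) {e : Idem S} (he : e ≠ ⊥) :
    ∃ f f' : Idem S, f ≠ ⊥ ∧ f' ≠ ⊥ ∧ Disjoint f f' ∧ f ⊔ f' = e := by
  by_contra! hn
  have hatom : ∀ x ≤ e, x = ⊥ ∨ x = e := fun x hx => by
    by_contra! h
    refine hn x (e \ x) h.1 (fun h1 => h.2 ?_) disjoint_sdiff_self_right
      (sup_sdiff_cancel_right hx)
    exact le_antisymm hx (sdiff_eq_bot_iff.1 h1)
  have hfin : ∀ x, DomCover e x → (Set.Iic x).Finite := by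
    intro x hx
    induction hx with
    | dom a ha =>
      refine Set.Finite.of_finite_image (f := munn a)
        ((Set.toFinite {⊥, e}).subset ?_) ?_
      · rintro _ ⟨y, -, rfl⟩
        exact hatom _ ((munn_le_ran a y).trans ha)
      · intro y hy z hz h
        have h1 := congrArg (munn a⁻¹) h
        rwa [munn_inv_munn, munn_inv_munn, inf_eq_left.2 hy, inf_eq_left.2 hz] at h1
    | @sup x x' _ _ ih ih' =>
      refine ((ih.prod ih').image fun p => p.1 ⊔ p.2).subset fun y hy => ?_
      exact ⟨(y ⊓ x, y ⊓ x'), ⟨inf_le_right, inf_le_right⟩, by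
        change y ⊓ x ⊔ y ⊓ x' = y
        rw [← inf_sup_left]; exact inf_eq_left.2 hy⟩
  have h1 := hfin ⊤ (domCover_of_isZeroSimplifying hS.2 he ⊤)
  rw [Set.Iic_top, Set.finite_univ_iff] at h1
  have := finite_of_finite_idem hS.1
  exact not_finite S

end

end BooleanInverseMonoid

/-! ### Supports of units and the axioms of `InvolutionAction`. -/

namespace BooleanInverseMeetMonoid

open InverseMonoidWithZero BooleanInverseMonoid

section

variable {S : Type*} [BooleanInverseMeetMonoid S]

theorem le_fix_iff (s : S) (e : Idem S) : e ≤ fix s ↔ s * e.val = e.val := by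
  rw [le_iff, ← idem_le_iff e.idem]
  have h := isGLB_meet s 1
  refine ⟨fun h1 => h1.trans (h.1 (by simp)), fun h1 => h.2 ?_⟩
  rintro _ (rfl | rfl)
  · exact h1
  · rw [idem_le_iff e.idem, one_mul]

theorem supp_unit (g : Sˣ) : supp (g : S) = (fix (g : S))ᶜ :=
  Idem.ext (by simp only [supp, ← units_inv, Units.inv_mul, mul_one])

theorem supp_unit_le_iff (hS : IsFundamental S) (g : Sˣ) (e : Idem S) :
    supp (g : S) ≤ e ↔ ∀ x, Disjoint x e → munn (g : S) x = x := by
  rw [supp_unit, compl_le_iff_compl_le, le_fix_iff, mul_eq_self_iff hS]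
  simp only [le_compl_iff_disjoint_right]

theorem le_supp_unit (hS : IsFundamental S) {g : Sˣ} {c : Idem S}
    (h : Disjoint c (munn (g : S) c)) : c ≤ supp (g : S) := by
  rw [← sdiff_eq_bot_iff, ← disjoint_self]
  have h1 : munn (g : S) (c \ supp (g : S)) = c \ supp (g : S) :=
    (supp_unit_le_iff hS g _).1 le_rfl _ disjoint_sdiff_self_left
  nth_rw 2 [← h1]
  exact h.mono sdiff_le (munn_mono _ sdiff_le)

/-- Every subgroup containing `Sym(S)` contains an involution exchanging the domain and the range
of a given element of square zero. -/
theorem exists_swap_mem (hS : IsFundamental S) {G : Subgroup Sˣ}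
    (hG : BooleanInverseMonoid.Sym S ≤ G) {a : S}
    (ha : a * a = 0) : ∃ u ∈ G, u * u = 1 ∧ supp (u : S) = dom a ⊔ ran a ∧
      (∀ x ≤ dom a, munn (u : S) x = munn a x) ∧ ∀ x ≤ ran a, munn (u : S) x = munn a⁻¹ x := by
  obtain ⟨u, hu2, hlub, hd, hr, hc⟩ := exists_swap ha
  have hud : ∀ x ≤ dom a, munn (u : S) x = munn a x := fun x hx =>
    munn_eq_munn_of_mul_eq (by rw [hd, mul_dom]) hx
  have hur : ∀ x ≤ ran a, munn (u : S) x = munn a⁻¹ x := fun x hx =>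
    munn_eq_munn_of_mul_eq (by rw [hr, ← dom_inv, mul_dom]) hx
  have hdisj := (sq_eq_zero_iff a).1 ha
  refine ⟨u, ?_, hu2, le_antisymm ?_ (sup_le (le_supp_unit hS ?_) (le_supp_unit hS ?_)), hud, hur⟩
  -- Special involutions require `a ≠ 0`; for `a = 0` the swap degenerates to the identity.
  · by_cases ha0 : a = 0
    · have : u = 1 := by
        have he : (extent a)ᶜ = ⊤ := by rw [extent, ha0, dom_zero, ran_zero]; simp
        rw [he, val_top, mul_one] at hc
        exact Units.ext hc
      rw [this]
      exact G.one_mem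
    · exact hG (Subgroup.subset_closure ⟨a, ha0, ha, hlub⟩)
  · rw [supp_unit_le_iff hS]
    intro x hx
    rw [munn_eq_munn_of_mul_eq (b := 1) (e := (extent a)ᶜ) (by rw [hc, one_mul])
      (le_compl_iff_disjoint_right.2 hx), munn_one]
  · rw [hud _ le_rfl, munn_dom]
    exact hdisj
  · rw [hur _ le_rfl, ← dom_inv, munn_dom, ← dom_inv, inv_inv_eq, dom_inv]
    exact hdisj.symm

/-- Split `e` into disjoint nonzero `f` and `f'`. Cover `f` by domains of elements with range below
`f'`; restricted to `f`, these have square zero, and their swaps have supports that cover `f` and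
stay below `e`. Exchanging the roles covers `f'`. -/
theorem exists_sup_supp [Infinite S] (hS : IsSimple S) {G : Subgroup Sˣ}
    (hG : BooleanInverseMonoid.Sym S ≤ G)
    (e : Idem S) : ∃ F : Finset G, (∀ t ∈ F, t * t = 1) ∧
      F.sup (fun g => supp ((g : Sˣ) : S)) = e := by
  classical
  set D : Idem S → Prop := fun e => ∃ F : Finset G, (∀ t ∈ F, t * t = 1) ∧
    F.sup (fun g => supp ((g : Sˣ) : S)) = e
  have hsup : ∀ e e', D e → D e' → D (e ⊔ e') := by
    rintro _ _ ⟨F, hF, rfl⟩ ⟨F', hF', rfl⟩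
    refine ⟨F ∪ F', fun t ht => ?_, Finset.sup_union⟩
    rcases Finset.mem_union.1 ht with h | h
    exacts [hF t h, hF' t h]
  have key : ∀ f f' : Idem S, f' ≠ ⊥ → Disjoint f f' → ∃ k, D k ∧ f ≤ k ∧ k ≤ f ⊔ f' := by
    intro f f' hf' hd
    have h : ∀ x, DomCover f' x → x ≤ f → ∃ k, D k ∧ x ≤ k ∧ k ≤ f ⊔ f' := by
      intro x hx
      induction hx with
      | dom a ha =>
        intro hxf
        obtain ⟨u, huG, hu2, hus, -⟩ :=
          exists_swap_mem hS.1 hG ((sq_eq_zero_iff a).2 (hd.mono hxf ha))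
        refine ⟨dom a ⊔ ran a, ⟨{⟨u, huG⟩}, ?_, ?_⟩, le_sup_left, sup_le_sup hxf ha⟩
        · intro t ht
          rw [Finset.mem_singleton.1 ht]
          exact Subtype.ext hu2
        · rw [Finset.sup_singleton]
          exact hus
      | sup _ _ ih ih' =>
        intro hxf
        obtain ⟨k, h1, h2, h3⟩ := ih (le_sup_left.trans hxf)
        obtain ⟨k', h1', h2', h3'⟩ := ih' (le_sup_right.trans hxf)
        exact ⟨k ⊔ k', hsup _ _ h1 h1', sup_le_sup h2 h2', sup_le h3 h3'⟩
    exact h f (domCover_of_isZeroSimplifying hS.2 hf' f) le_rfl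
  by_cases he : e = ⊥
  · exact ⟨∅, by simp, by simp [he]⟩
  obtain ⟨f, f', hf, hf', hd, rfl⟩ := exists_split hS he
  obtain ⟨k, h1, h2, h3⟩ := key f f' hf' hd
  obtain ⟨k', h1', h2', h3'⟩ := key f' f hf hd.symm
  have h4 := hsup _ _ h1 h1'
  rwa [le_antisymm (sup_le h3 (h3'.trans_eq (sup_comm _ _))) (sup_le_sup h2 h2')] at h4

/-- The action on the idempotents of a group of units containing `Sym(S)`. -/
noncomputable def involutionAction [Infinite S] (hS : IsSimple S) (G : Subgroup Sˣ)
    (hG : BooleanInverseMonoid.Sym S ≤ G) : InvolutionAction G (Idem S) where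
  act := unitsAct.comp G.subtype
  supp g := supp ((g : Sˣ) : S)
  faithful g h := by
    have h1 : ∀ x ≤ (⊤ : Idem S), munn ((g : Sˣ) : S) x = x := fun x _ =>
      (unitsAct_apply (g : Sˣ) x).symm.trans (h x)
    rw [← mul_eq_self_iff hS.1, val_top, mul_one] at h1
    exact Subtype.ext (Units.ext h1)
  supp_le_iff g e := by
    rw [supp_unit_le_iff hS.1]
    simp only [← unitsAct_apply]
    rfl
  restrict t c ht hc := by
    have hact : ∀ (g : G) x, (unitsAct.comp G.subtype) g x = munn ((g : Sˣ) : S) x := fun g x =>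
      unitsAct_apply _ x
    have htt : ((t : Sˣ) : S) * ((t : Sˣ) : S) = 1 :=
      congrArg (fun g : G => ((g : Sˣ) : S)) ht
    simp only [hact] at hc ⊢
    generalize hs : ((t : Sˣ) : S) = s at *
    have hsinv : s⁻¹ = s := by
      refine (inv_unique s s ?_ ?_).symm <;> rw [htt, one_mul]
    have hdom : dom (s * c.val) = c := by
      rw [dom_mul_idem]
      refine inf_eq_right.2 (le_top.trans_eq (Idem.ext ?_))
      simp only [dom, val_top, hsinv, htt]
    have hran : ran (s * c.val) = munn s c := by rw [ran_mul, ran_idem]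
    have hmm : ∀ x, munn s (munn s x) = x := fun x => by rw [← munn_mul, htt, munn_one]
    -- The element `sc` has domain `c` and range `scs⁻¹`, which are disjoint, so its swap is the
    -- restriction of `t` to their join.
    obtain ⟨u, huG, -, hus, hud, hur⟩ := exists_swap_mem hS.1 hG (a := s * c.val)
      ((sq_eq_zero_iff _).2 (by rw [hdom, hran]; exact hc))
    rw [hdom, hran] at hus
    rw [hdom] at hud
    rw [hran] at hur
    have h1 : ∀ x ≤ c, munn (u : S) x = munn s x := fun x hx => by
      rw [hud x hx, munn_mul_idem s hx]
    have h2 : ∀ x ≤ munn s c, munn (u : S) x = munn s x := fun x hx => by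
      have h3 : munn s x ≤ c := (munn_mono s hx).trans_eq (hmm c)
      rw [hur x hx, inv_mul_eq, inv_of_idem c.idem, hsinv, munn_mul,
        ← one_mul c.val, munn_mul_idem _ h3, munn_one]
    refine ⟨⟨u, huG⟩, hus.le, fun x hx => ?_⟩
    change munn (u : S) x = munn s x
    rw [← inf_eq_left.2 hx, inf_sup_left, munn_sup, munn_sup, h1 _ inf_le_right,
      h2 _ inf_le_right]
  exists_sup e := exists_sup_supp hS hG e

end

end BooleanInverseMeetMonoid

theorem mainTheorem4 {S : Type*} {T : Type*} [TarskiMonoid S] [TarskiMonoid T]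
    (hS : BooleanInverseMonoid.IsSimple S) (hT : BooleanInverseMonoid.IsSimple T)
    (G : Subgroup Sˣ) (H : Subgroup Tˣ)
    (hG : BooleanInverseMonoid.Sym S ≤ G) (hH : BooleanInverseMonoid.Sym T ≤ H)
    (α : G ≃* H) :
    ∃ γ : InverseMonoidWithZero.Idem S ≃o InverseMonoidWithZero.Idem T,
      (∀ t : G, t ≠ 1 → t ^ 2 = 1 →
        γ (BooleanInverseMeetMonoid.supp ((t : Sˣ) : S)) =
          BooleanInverseMeetMonoid.supp ((α t : Tˣ) : T)) ∧
      (∀ (g : G) (e : InverseMonoidWithZero.Idem S),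
        γ (InverseMonoidWithZero.conj (g : Sˣ) e) =
          InverseMonoidWithZero.conj (α g : Tˣ) (γ e)) := by
  have := TarskiMonoid.infinite (S := S)
  have := TarskiMonoid.infinite (S := T)
  obtain ⟨γ, h1, h2⟩ := InvolutionAction.exists_orderIso
    (BooleanInverseMeetMonoid.involutionAction hS G hG)
    (BooleanInverseMeetMonoid.involutionAction hT H hH) α
  exact ⟨γ, fun t _ ht => h1 t (by rw [← sq, ht]), h2⟩
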